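/- Let $G=(V,E)$ be a finite graph, possibly with loops and multiple edges, with nonnegative real edge weights $\boldsymbol\lambda=(\lambda_e)_{e\in E}$. For $H\subseteq E$ and $v\in V$ let $\deg(H,v)$ be the degree of $v$ in the spanning subgraph $(V,H)$ (a loop counts twice), and put $\deg(G,v)=\deg(E,v)$. For activities $u_0,u_1,u_2,\dots\in\mathbb C$ (the same at every vertex) let $$Z(\mathbf x)=Z(G,\boldsymbol\lambda,\mathbf u;\mathbf x)=\sum_{H\subseteq E}\Big(\prod_{e\in H}\lambda_e\Big)\prod_{v\in V}u_{\deg(H,v)}\,x_v^{\deg(H,v)},$$ let $Z(y)=Z(G,\boldsymbol\lambda,\mathbf u;y^{1/2}\mathbf 1)$, that is $$Z(y)=\sum_{H\subseteq E}\Big(\prod_{e\in H}\lambda_e\Big)\Big(\prod_{v\in V}u_{\deg(H,v)}\Big)y^{\#H},$$ be the univariate polynomial obtained by setting all $x_v$ equal to $y^{1/2}$, and for $v\in V$ let $K_v(z)=\sum_{j=0}^{d}\binom dj u_jz^j$ with $d=\deg(G,v)$ be the key polynomial at $v$. For $0<\theta\le\pi$ let $S[\theta]=\{z\in\mathbb C: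 z\ne0,\ |\arg z|<\theta\}$, where $-\pi<\arg z\le\pi$. A complex polynomial $F$ in one or several variables is called $A$-nonvanishing, for $A\subseteq\mathbb C$, if either $F$ is identically zero or $F\neq0$ whenever all its variables take values in $A$. Let $u\in\mathbb R$ and take the activities $u_0=u_2=1$, $u_1=u$, and $u_k=0$ for $k>2$. (i) If $u=1$, then every key polynomial $K_v(z)$ is $S[3\pi/4]$-nonvanishing, $Z(\mathbf x)$ is $S[\pi/4]$-nonvanishing, and $Z(y)$ is $S[\pi/2]$-nonvanishing. (ii) Let $\Delta$ be the maximum degree of $G$, and suppose $u\ge\sqrt{2-2/\Delta}$ (no condition on $u$ if $\Delta=0$, i.e. if $G$ has no edges). Then every key polynomial $K_v(z)$ is $S[\pi]$-nonvanishing, $Z(\mathbf x)$ is $S[\pi/2]$-nonvanishing, and $Z(y)$ is $S[\pi]$-nonvanishing; moreover every zero of $Z(y)$ is real and nonpositive. -/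

import Mathlib

open scoped Graph

noncomputable section

namespace SubgraphPoly

variable {α β : Type*}

open Classical in
/-- The degree of the vertex `v` in the spanning subgraph of the multigraph `G` with edge set `H`:
the number of edges of `H` incident with `v`, loops being counted twice. -/
def degree (G : Graph α β) (H : Finset E(G)) (v : V(G)) : ℕ :=
  (H.filter fun e : E(G) => G.Inc e v).card + (H.filter fun e : E(G) => G.IsLoopAt e v).card

/-- The maximum degree of a vertex of the finite multigraph `G` (`0` if there is no vertex). -/
def maxDegree (G : Graph α β) [Fintype V(G)] [Fintype E(G)] : ℕ :=
  Finset.univ.sup fun v : V(G) => degree G Finset.univ v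

/-- The weight `λ^H u_{deg H}` of the spanning subgraph with edge set `H`; the activity of `v`
at degree `k` is `u v k`. -/
def weight (G : Graph α β) [Fintype V(G)] (lam : E(G) → ℂ) (u : V(G) → ℕ → ℂ)
    (H : Finset E(G)) : ℂ :=
  (∏ e ∈ H, lam e) * ∏ v, u v (degree G H v)

/-- `Z(G, λ, u; x) = ∑_{H ⊆ E} λ^H u_{deg H} x^{deg H}`. -/
def Z (G : Graph α β) [Fintype V(G)] [Fintype E(G)] (lam : E(G) → ℂ) (u : V(G) → ℕ → ℂ) :
    MvPolynomial V(G) ℂ :=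
  ∑ H : Finset E(G),
    MvPolynomial.C (weight G lam u H) * ∏ v, MvPolynomial.X v ^ degree G H v

/-- The univariate polynomial `Z(G, λ, u; y^{1/2} 𝟏) = ∑_{H ⊆ E} λ^H u_{deg H} y^{#H}` in the
variable `y`. That it is obtained by this substitution is `expand_two_Zuni`. -/
def Zuni (G : Graph α β) [Fintype V(G)] [Fintype E(G)] (lam : E(G) → ℂ) (u : V(G) → ℕ → ℂ) :
    Polynomial ℂ :=
  ∑ H : Finset E(G), Polynomial.C (weight G lam u H) * Polynomial.X ^ H.card

/-- The key polynomial `K_v(z) = ∑_{j=0}^d (d choose j) u_j^{(v)} z^j` with `d = deg(G, v)`. -/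
def key (G : Graph α β) [Fintype E(G)] (u : V(G) → ℕ → ℂ) (v : V(G)) : Polynomial ℂ :=
  ∑ j ∈ Finset.range (degree G Finset.univ v + 1),
    Polynomial.C (((degree G Finset.univ v).choose j : ℂ) * u v j) * Polynomial.X ^ j

/-- The handshake lemma. -/
theorem sum_degree (G : Graph α β) [Fintype V(G)] (H : Finset E(G)) :
    ∑ v, degree G H v = 2 * H.card := by
  classical
  have h : ∀ e : E(G), (∑ v : V(G), ((if G.Inc e v then 1 else 0) +
      (if G.IsLoopAt e v then 1 else 0))) = 2 := by
    rintro ⟨e, he⟩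
    obtain ⟨x, y, hxy⟩ := (G.edge_mem_iff_exists_isLink e).1 he
    have hInc : ∀ v : V(G), G.Inc e v ↔ v = ⟨x, hxy.left_mem⟩ ∨ v = ⟨y, hxy.right_mem⟩ := by
      intro v
      rw [Subtype.ext_iff, Subtype.ext_iff]
      constructor
      · rintro ⟨w, hw⟩
        exact hw.left_eq_or_eq hxy
      · rintro (h | h)
        · rw [h]; exact hxy.inc_left
        · rw [h]; exact hxy.inc_right
    have hLoop : ∀ v : V(G), G.IsLoopAt e v ↔
        v = ⟨x, hxy.left_mem⟩ ∧ v = ⟨y, hxy.right_mem⟩ := by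
      intro v
      rw [Subtype.ext_iff, Subtype.ext_iff]
      constructor
      · intro h
        have h' : G.IsLink e v v := h
        exact ⟨(hxy.left_eq_or_eq h').elim Eq.symm Eq.symm,
          (hxy.symm.left_eq_or_eq h').elim Eq.symm Eq.symm⟩
      · rintro ⟨h1, h2⟩
        change G.IsLink e v v
        have h3 : G.IsLink e v y := by rw [h1]; exact hxy
        have h4 : (v : α) = y := h2
        rw [← h4] at h3
        exact h3
    have key : ∀ v : V(G), ((if G.Inc e v then 1 else 0) + (if G.IsLoopAt e v then 1 else 0)) =
        (if v = ⟨x, hxy.left_mem⟩ then 1 else 0) + (if v = ⟨y, hxy.right_mem⟩ then 1 else 0) := by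
      intro v
      simp only [hInc v, hLoop v]
      by_cases h1 : v = ⟨x, hxy.left_mem⟩ <;> by_cases h2 : v = ⟨y, hxy.right_mem⟩ <;>
        simp [h1, h2]
      all_goals simp_all
    rw [Finset.sum_congr rfl fun v _ => key v, Finset.sum_add_distrib]
    simp
  simp only [degree, Finset.card_filter, ← Finset.sum_add_distrib]
  rw [Finset.sum_comm, Finset.sum_congr rfl fun e _ => h e]
  simp [mul_comm]

/-- Substituting `y = x ^ 2` in `Zuni` gives the value of `Z` at `x 𝟏 = (x, …, x)`. -/
theorem expand_two_Zuni (G : Graph α β) [Fintype V(G)] [Fintype E(G)] (lam : E(G) → ℂ)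
    (u : V(G) → ℕ → ℂ) :
    Polynomial.expand ℂ 2 (Zuni G lam u) =
      MvPolynomial.aeval (fun _ => (Polynomial.X : Polynomial ℂ)) (Z G lam u) := by
  simp only [Zuni, Z, map_sum, map_mul, map_prod, map_pow, Polynomial.expand_C,
    Polynomial.expand_X, MvPolynomial.aeval_X, MvPolynomial.aeval_C, Finset.prod_pow_eq_pow_sum,
    sum_degree, ← pow_mul]
  rfl

/-- The open sector `S[θ]`. -/
def sector (θ : ℝ) : Set ℂ := {z | z ≠ 0 ∧ |z.arg| < θ}

/-- A multivariate polynomial `F` is `A`-nonvanishing if `F ≡ 0` or `F` has no zero all of whose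
coordinates lie in `A`. -/
def Nonvanishing {σ : Type*} (A : Set ℂ) (F : MvPolynomial σ ℂ) : Prop :=
  F = 0 ∨ ∀ z : σ → ℂ, (∀ v, z v ∈ A) → MvPolynomial.eval z F ≠ 0

/-- The same notion for a polynomial in one variable. -/
def Nonvanishing₁ (A : Set ℂ) (P : Polynomial ℂ) : Prop :=
  P = 0 ∨ ∀ z ∈ A, P.eval z ≠ 0

/-- The activities `u_0 = u_2 = 1`, `u_1 = u` and `u_k = 0` for `k > 2`. -/
def ruelleActivity (u : ℝ) (k : ℕ) : ℂ :=
  if k = 0 ∨ k = 2 then 1 else if k = 1 then (u : ℂ) else 0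

end SubgraphPoly

end

/-! If each vertex carries powers t_v^k instead of activities, the sum over H factors into edge
terms 1 + λ_e t_a t_b, and none vanishes when every t_v is 0 or has positive real part.
`partition_ne_zero` then switches the vertices one at a time to u_k x_v^k. With the other vertices
fixed, the sum is a polynomial f in t_v without zeros in `pointedHalfPlane`, and the switch is a
Schur–Szegő composition of f with K_v(x_v z). As K_v is at most quadratic, the Grace-type theorem
needed reduces to a variance estimate, `polar_ne_zero`. Which x_v are `Admissible` is read off the
discriminant of K_v. The claim on Z(y) follows by y = x^2, and that on K_v by taking f = (1 + wX)^d.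
-/

/-! ### Schur–Szegő composition with a quadratic polynomial. -/

/-- A pencil of points of the closed right half-plane: the bilinear polarisation of its second
elementary symmetric function has no zero in the open right half-plane. -/
theorem polar_ne_zero {ι : Type*} (s : Finset ι) (c : ι → ℂ) (d : ℕ) (hd : 2 ≤ d)
    (hs : s.card = d) (hc : ∀ i ∈ s, 0 ≤ (c i).re) (w₁ w₂ : ℂ) (h₁ : 0 < w₁.re)
    (h₂ : 0 < w₂.re) :
    (d : ℂ) * (d - 1) + (d - 1) * (∑ i ∈ s, c i) * (w₁ + w₂) +
      ((∑ i ∈ s, c i) ^ 2 - ∑ i ∈ s, c i ^ 2) * (w₁ * w₂) ≠ 0 := by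
  intro h0
  have hw₁ : w₁ ≠ 0 := by rintro rfl; simp at h₁
  have hw₂ : w₂ ≠ 0 := by rintro rfl; simp at h₂
  have hs₁ : 0 < (w₁⁻¹).re := by
    rw [Complex.inv_re]; exact div_pos h₁ (Complex.normSq_pos.2 hw₁)
  have hs₂ : 0 < (w₂⁻¹).re := by
    rw [Complex.inv_re]; exact div_pos h₂ (Complex.normSq_pos.2 hw₂)
  have hdR : (2 : ℝ) ≤ d := by exact_mod_cast hd
  have hd0 : (d : ℂ) ≠ 0 := by
    have : d ≠ 0 := by omega
    exact_mod_cast this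
  set E := ∑ i ∈ s, c i with hE
  set Q := ∑ i ∈ s, c i ^ 2 with hQ
  set M := E / d with hM
  have hEM : E = d * M := by rw [hM]; field_simp
  have hMre : M.re * d = ∑ i ∈ s, (c i).re := by
    have : (d * M).re = ∑ i ∈ s, (c i).re := by rw [← hEM, hE, Complex.re_sum]
    rw [← this]; simp [mul_comm]
  have hM0 : 0 ≤ M.re := by
    have := Finset.sum_nonneg hc
    rw [← hMre] at this
    nlinarith
  have hV : ∑ i ∈ s, (c i - M) ^ 2 = Q - d * M ^ 2 := by
    have : ∀ i ∈ s, (c i - M) ^ 2 = c i ^ 2 - 2 * M * c i + M ^ 2 := fun i _ => by ring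
    rw [Finset.sum_congr rfl this, Finset.sum_add_distrib, Finset.sum_sub_distrib,
      ← Finset.mul_sum, Finset.sum_const, hs, ← hE, ← hQ, hEM, nsmul_eq_mul]
    ring
  -- Divided by w₁w₂ and recentred at the mean M of the c i, the vanishing becomes an identity for
  -- the sum of squared deviations. Below, its real part and its modulus are added.
  have hy : (d : ℂ) * (d - 1) * ((w₁⁻¹ + M) * (w₂⁻¹ + M)) = ∑ i ∈ s, (c i - M) ^ 2 := by
    rw [hV]
    rw [hEM] at h0
    field_simp
    linear_combination h0
  set y₁ := w₁⁻¹ + M with hy₁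
  set y₂ := w₂⁻¹ + M with hy₂
  have hy₁' : M.re < y₁.re := by rw [hy₁, Complex.add_re]; linarith
  have hy₂' : M.re < y₂.re := by rw [hy₂, Complex.add_re]; linarith
  have hre : (d : ℝ) * (d - 1) * (y₁ * y₂).re = ∑ i ∈ s, ((c i - M) ^ 2).re := by
    rw [← Complex.re_sum, ← hy]
    have : ((d : ℂ) * (d - 1)) = ((d * (d - 1) : ℝ) : ℂ) := by push_cast; ring
    rw [this, Complex.re_ofReal_mul]
  have hnorm : (d : ℝ) * (d - 1) * ‖y₁ * y₂‖ ≤ ∑ i ∈ s, ‖c i - M‖ ^ 2 := by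
    have : ((d : ℂ) * (d - 1)) = ((d * (d - 1) : ℝ) : ℂ) := by push_cast; ring
    have h := congrArg norm hy
    rw [norm_mul, this, Complex.norm_real, Real.norm_of_nonneg (by nlinarith)] at h
    rw [h]
    refine (norm_sum_le _ _).trans (le_of_eq (Finset.sum_congr rfl fun i _ => norm_pow _ _))
  have hprod : 2 * (y₁.re * y₂.re) ≤ (y₁ * y₂).re + ‖y₁ * y₂‖ := by
    have h1 : (y₁ * star y₂).re ≤ ‖y₁ * y₂‖ := by
      refine (Complex.re_le_norm _).trans (le_of_eq ?_)
      rw [norm_mul, norm_mul, norm_star]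
    simp [Complex.mul_re] at h1 ⊢
    linarith
  have hterm : ∀ z : ℂ, (z ^ 2).re + ‖z‖ ^ 2 = 2 * z.re ^ 2 := by
    intro z
    rw [Complex.sq_norm, Complex.normSq_apply, pow_two z, Complex.mul_re]
    ring
  have hsum : (d : ℝ) * (d - 1) * (2 * (y₁.re * y₂.re)) ≤ ∑ i ∈ s, 2 * (c i - M).re ^ 2 := by
    rw [← Finset.sum_congr rfl fun i _ => hterm (c i - M), Finset.sum_add_distrib, ← hre]
    nlinarith [mul_le_mul_of_nonneg_left hprod (show (0 : ℝ) ≤ d * (d - 1) by nlinarith)]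
  -- Bounds the real deviations by d(d - 1)(Re M)^2, against Re yᵢ > Re M ≥ 0.
  have hsq : ∑ i ∈ s, (c i).re ^ 2 ≤ (∑ i ∈ s, (c i).re) ^ 2 := Finset.sum_sq_le_sq_sum_of_nonneg hc
  have hexp : ∑ i ∈ s, 2 * (c i - M).re ^ 2 = 2 * (∑ i ∈ s, (c i).re ^ 2 - d * M.re ^ 2) := by
    have : ∀ i ∈ s, 2 * (c i - M).re ^ 2 =
        2 * (c i).re ^ 2 - 4 * M.re * (c i).re + 2 * M.re ^ 2 := fun i _ => by
      rw [Complex.sub_re]; ring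
    rw [Finset.sum_congr rfl this, Finset.sum_add_distrib, Finset.sum_sub_distrib,
      ← Finset.mul_sum, ← Finset.mul_sum, Finset.sum_const, hs, ← hMre, nsmul_eq_mul]
    ring
  rw [hexp] at hsum
  rw [← hMre] at hsq
  have hlt : M.re * M.re < y₁.re * y₂.re := by nlinarith
  have hpos : 0 < (d : ℝ) * (d - 1) := by nlinarith
  nlinarith [mul_lt_mul_of_pos_left hlt hpos]

/-- The open right half-plane together with the origin. -/
def pointedHalfPlane : Set ℂ := {z | z = 0 ∨ 0 < z.re}

open Polynomial in
/-- A polynomial with value `1` at the origin factors into `1 + cᵢ X`. -/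
theorem exists_prod_one_add (d : ℕ) : ∀ f : ℂ[X], f.natDegree ≤ d → f.coeff 0 = 1 →
    ∃ c : Fin d → ℂ, f = ∏ i, (1 + C (c i) * X) := by
  induction d with
  | zero =>
    intro f hf h0
    refine ⟨fun _ => 0, ?_⟩
    rw [eq_C_of_natDegree_le_zero hf, h0]
    simp
  | succ n ih =>
    intro f hf h0
    by_cases hn : f.natDegree ≤ n
    · obtain ⟨c, hc⟩ := ih f hn h0
      -- A missing degree is padded with the trivial factor 1 + 0·X.
      refine ⟨Fin.cons 0 c, ?_⟩
      rw [Fin.prod_univ_succ]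
      simpa using hc
    · have hdeg : f.degree ≠ 0 := fun h => by
        exact hn ((natDegree_eq_of_degree_eq_some h).trans_le (Nat.zero_le n))
      obtain ⟨r, hr⟩ := IsAlgClosed.exists_root f hdeg
      obtain ⟨g, rfl⟩ := dvd_iff_isRoot.2 hr
      have hr0 : -r * g.coeff 0 = 1 := by
        rw [← h0, mul_coeff_zero]; simp
      have hrne : r ≠ 0 := by rintro rfl; simp at hr0
      have hg0 : g ≠ 0 := by rintro rfl; simp at hr0
      have hg : (C (-r) * g).natDegree ≤ n := by
        rw [natDegree_mul (X_sub_C_ne_zero r) hg0, natDegree_X_sub_C] at hf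
        exact natDegree_C_mul_le _ _ |>.trans (by omega)
      obtain ⟨c, hc⟩ := ih (C (-r) * g) hg (by rw [coeff_C_mul, hr0])
      refine ⟨Fin.cons (-r⁻¹) c, ?_⟩
      rw [Fin.prod_univ_succ]
      simp only [Fin.cons_zero, Fin.cons_succ]
      rw [← hc]
      have h1 : (C r⁻¹ * C r : ℂ[X]) = 1 := by rw [← C_mul, inv_mul_cancel₀ hrne, C_1]
      simp only [C_neg]
      linear_combination -(X * g) * h1

open Polynomial in
/-- The lowest coefficients of `∏ (1 + cᵢ X)`. -/
theorem coeff_prod_one_add {ι : Type*} (s : Finset ι) (c : ι → ℂ) :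
    (∏ i ∈ s, (1 + C (c i) * X)).coeff 0 = 1 ∧
    (∏ i ∈ s, (1 + C (c i) * X)).coeff 1 = ∑ i ∈ s, c i ∧
    2 * (∏ i ∈ s, (1 + C (c i) * X)).coeff 2 = (∑ i ∈ s, c i) ^ 2 - ∑ i ∈ s, c i ^ 2 := by
  classical
  induction s using Finset.induction_on with
  | empty => simp [coeff_one]
  | insert a s ha ih =>
    obtain ⟨h0, h1, h2⟩ := ih
    rw [Finset.prod_insert ha, Finset.sum_insert ha, Finset.sum_insert ha]
    have e : ∀ p : ℂ[X], (1 + C (c a) * X) * p = p + C (c a) * (X * p) := fun p => by ring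
    refine ⟨?_, ?_, ?_⟩
    · rw [e, coeff_add, coeff_C_mul, coeff_X_mul_zero, h0]; ring
    · rw [e, coeff_add, coeff_C_mul, show (1 : ℕ) = 0 + 1 from rfl, coeff_X_mul, h0, zero_add, h1]
      ring
    · rw [e, coeff_add, coeff_C_mul, show (2 : ℕ) = 1 + 1 from rfl, coeff_X_mul, h1]
      linear_combination h2

open Polynomial in
/-- The Schur–Szegő composition of a polynomial without zeros in the pointed half-plane and a
quadratic one. -/
theorem schurSzego_quadratic_ne_zero (f : ℂ[X]) (d : ℕ) (hd : 2 ≤ d) (hf : f.natDegree ≤ d)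
    (hz : ∀ t ∈ pointedHalfPlane, f.eval t ≠ 0) (w₁ w₂ : ℂ) (h₁ : 0 < w₁.re) (h₂ : 0 < w₂.re) :
    (d : ℂ) * (d - 1) * f.coeff 0 + (d - 1) * f.coeff 1 * (w₁ + w₂) +
      2 * f.coeff 2 * (w₁ * w₂) ≠ 0 := by
  -- Here the origin in `pointedHalfPlane` is needed.
  have h0 : f.coeff 0 ≠ 0 := by
    rw [coeff_zero_eq_eval_zero]; exact hz 0 (Or.inl rfl)
  obtain ⟨c, hc⟩ := exists_prod_one_add d (C (f.coeff 0)⁻¹ * f)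
    ((natDegree_C_mul_le _ _).trans hf) (by rw [coeff_C_mul, inv_mul_cancel₀ h0])
  obtain ⟨-, k1, k2⟩ := coeff_prod_one_add Finset.univ c
  rw [← hc, coeff_C_mul] at k1 k2
  have hre : ∀ i ∈ Finset.univ, 0 ≤ (c i).re := by
    intro i _
    by_contra! hi
    have hci : c i ≠ 0 := by intro h; simp [h] at hi
    refine hz (-(c i)⁻¹) (Or.inr ?_) ?_
    · rw [Complex.neg_re, Complex.inv_re, ← neg_div]
      exact div_pos (by linarith) (Complex.normSq_pos.2 hci)
    · have h := congrArg (eval (-(c i)⁻¹)) hc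
      rw [eval_prod, Finset.prod_eq_zero (Finset.mem_univ i) (by simp [hci]), eval_mul,
        eval_C] at h
      exact (mul_eq_zero.1 h).resolve_left (inv_ne_zero h0)
  have key := polar_ne_zero Finset.univ c d hd (by simp) hre w₁ w₂ h₁ h₂
  rw [← k2, ← k1] at key
  contrapose! key
  have e : (f.coeff 0)⁻¹ * f.coeff 0 = 1 := inv_mul_cancel₀ h0
  linear_combination (f.coeff 0)⁻¹ * key - (d : ℂ) * (d - 1) * e

/-- Activity `u`, degree `d` and value `x` such that the key polynomial is `(1 + γ₁ z) (1 + γ₂ z)`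
with `γᵢ x` in the right half-plane. -/
def Admissible (u : ℝ) (d : ℕ) (x : ℂ) : Prop :=
  (d = 1 → (u : ℂ) * x ∈ pointedHalfPlane) ∧
  (2 ≤ d → ∃ w₁ w₂ : ℂ, 0 < w₁.re ∧ 0 < w₂.re ∧ w₁ + w₂ = d * u * x ∧
    2 * (w₁ * w₂) = d * (d - 1) * x ^ 2)

-- For d ≥ 2, multiplying by d(d - 1) gives the composition with (1 + w₁z)(1 + w₂z). For d ≤ 1 the
-- expression is a value of f itself.
open Polynomial SubgraphPoly in
theorem sum_coeff_mul_ruelleActivity_ne_zero {u : ℝ} {d : ℕ} {x : ℂ} (h : Admissible u d x)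
    (f : ℂ[X]) (hf : f.natDegree ≤ d) (hz : ∀ t ∈ pointedHalfPlane, f.eval t ≠ 0) :
    f.coeff 0 + f.coeff 1 * (u * x) + f.coeff 2 * x ^ 2 ≠ 0 := by
  rcases Nat.lt_or_ge d 2 with hd | hd
  · have h2 : f.coeff 2 = 0 := coeff_eq_zero_of_natDegree_lt (by omega)
    rw [h2]
    obtain rfl | rfl : d = 0 ∨ d = 1 := by omega
    · rw [coeff_eq_zero_of_natDegree_lt (show f.natDegree < 1 by omega), coeff_zero_eq_eval_zero]
      simpa using hz 0 (Or.inl rfl)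
    · have := hz _ (h.1 rfl)
      rw [eval_eq_sum_range' (show f.natDegree < 2 by omega)] at this
      simpa [Finset.sum_range_succ] using this
  · obtain ⟨w₁, w₂, h₁, h₂, ha, hm⟩ := h.2 hd
    have key := schurSzego_quadratic_ne_zero f d hd hf hz w₁ w₂ h₁ h₂
    contrapose! key
    rw [ha]
    linear_combination (d : ℂ) * (d - 1) * key + f.coeff 2 * hm

/-! ### Partition functions and the vertex-by-vertex switch. -/

namespace SubgraphPoly

variable {α β : Type*}

/-- The partition function with an arbitrary sequence at each vertex. -/
noncomputable def partition (G : Graph α β) [Fintype V(G)] [Fintype E(G)] (lam : E(G) → ℂ)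
    (U : V(G) → ℕ → ℂ) : ℂ :=
  ∑ H : Finset E(G), weight G lam U H

theorem degree_mono (G : Graph α β) {H K : Finset E(G)} (h : H ⊆ K) (v : V(G)) :
    degree G H v ≤ degree G K v := by
  classical
  exact Nat.add_le_add (Finset.card_le_card (Finset.filter_subset_filter _ h))
    (Finset.card_le_card (Finset.filter_subset_filter _ h))

/-- A loop is the case a = b, where its double count gives t a ^ 2. -/
theorem exists_ends (G : Graph α β) (e : E(G)) :
    ∃ a b : V(G), ∀ t : V(G) → ℂ, ∀ [Fintype V(G)],
      ∏ v, t v ^ degree G {e} v = t a * t b := by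
  classical
  obtain ⟨e, he⟩ := e
  obtain ⟨x, y, hxy⟩ := (G.edge_mem_iff_exists_isLink e).1 he
  refine ⟨⟨x, hxy.left_mem⟩, ⟨y, hxy.right_mem⟩, fun t _ => ?_⟩
  have hdeg : ∀ v : V(G), degree G {⟨e, he⟩} v =
      (if v = ⟨x, hxy.left_mem⟩ then 1 else 0) + (if v = ⟨y, hxy.right_mem⟩ then 1 else 0) := by
    intro v
    have hInc : G.Inc e v ↔ v = ⟨x, hxy.left_mem⟩ ∨ v = ⟨y, hxy.right_mem⟩ := by
      rw [Subtype.ext_iff, Subtype.ext_iff]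
      constructor
      · rintro ⟨w, hw⟩
        exact hw.left_eq_or_eq hxy
      · rintro (h | h)
        · rw [h]; exact hxy.inc_left
        · rw [h]; exact hxy.inc_right
    have hLoop : G.IsLoopAt e v ↔ v = ⟨x, hxy.left_mem⟩ ∧ v = ⟨y, hxy.right_mem⟩ := by
      rw [Subtype.ext_iff, Subtype.ext_iff]
      constructor
      · intro h
        have h' : G.IsLink e v v := h
        exact ⟨(hxy.left_eq_or_eq h').elim Eq.symm Eq.symm,
          (hxy.symm.left_eq_or_eq h').elim Eq.symm Eq.symm⟩
      · rintro ⟨h1, h2⟩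
        change G.IsLink e v v
        have h3 : G.IsLink e v y := by rw [h1]; exact hxy
        have h4 : (v : α) = y := h2
        rw [← h4] at h3
        exact h3
    simp only [degree, Finset.card_filter, Finset.sum_singleton, hInc, hLoop]
    have hpq : ∀ (p q : Prop) [Decidable p] [Decidable q],
        (if p ∨ q then 1 else 0) + (if p ∧ q then 1 else 0) =
          (if p then 1 else 0) + (if q then 1 else 0) := fun p q _ _ => by
      by_cases p <;> by_cases q <;> simp [*]
    exact hpq _ _
  simp only [hdeg, pow_add, Finset.prod_mul_distrib]
  simp [pow_ite, Finset.prod_ite_eq']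

theorem prod_pow_degree (G : Graph α β) [Fintype V(G)] (t : V(G) → ℂ) (H : Finset E(G)) :
    ∏ v, t v ^ degree G H v = ∏ e ∈ H, ∏ v, t v ^ degree G {e} v := by
  rw [Finset.prod_comm]
  refine Finset.prod_congr rfl fun v _ => ?_
  rw [Finset.prod_pow_eq_pow_sum]
  congr 1
  simp only [degree, Finset.card_filter, Finset.sum_singleton, Finset.sum_add_distrib]

/-- Two arguments in (-π/2, π/2) add up to one in (-π, π), so a * b is never a negative real. -/
theorem one_add_mul_ne_zero {l : ℝ} (hl : 0 ≤ l) {a b : ℂ} (ha : a ∈ pointedHalfPlane)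
    (hb : b ∈ pointedHalfPlane) : 1 + (l : ℂ) * (a * b) ≠ 0 := by
  rcases ha with rfl | ha
  · simp
  rcases hb with rfl | hb
  · simp
  intro h
  have hre := congrArg Complex.re h
  have him := congrArg Complex.im h
  simp [Complex.mul_re, Complex.mul_im] at hre him
  have hl0 : l ≠ 0 := by rintro rfl; simp at hre
  have him' := him.resolve_left hl0
  have hl' : 0 < l := lt_of_le_of_ne hl hl0.symm
  have : a.re * b.re - a.im * b.im < 0 := by
    by_contra! hcon
    nlinarith [mul_nonneg hl hcon]
  have h3 : a.im * b.im * (b.re * b.re) = -(b.im * b.im) * (a.re * b.re) := by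
    linear_combination b.re * b.im * him'
  nlinarith [mul_pos ha hb, mul_pos hb hb, mul_nonneg (mul_self_nonneg b.im) (mul_pos ha hb).le]

theorem partition_pow_ne_zero (G : Graph α β) [Fintype V(G)] [Fintype E(G)] (lam : E(G) → ℝ)
    (hlam : ∀ e, 0 ≤ lam e) (t : V(G) → ℂ) (ht : ∀ v, t v ∈ pointedHalfPlane) :
    partition G (fun e => (lam e : ℂ)) (fun v k => t v ^ k) ≠ 0 := by
  classical
  have h : partition G (fun e => (lam e : ℂ)) (fun v k => t v ^ k) =
      ∏ e, (1 + (lam e : ℂ) * ∏ v, t v ^ degree G {e} v) := by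
    rw [Finset.prod_one_add, Finset.powerset_univ]
    refine Finset.sum_congr rfl fun H _ => ?_
    rw [weight, prod_pow_degree, Finset.prod_mul_distrib]
  rw [h, Finset.prod_ne_zero_iff]
  intro e _
  obtain ⟨a, b, hab⟩ := exists_ends G e
  rw [hab]
  exact one_add_mul_ne_zero (hlam e) (ht a) (ht b)

open Polynomial in
/-- Replacing powers of points of the pointed half-plane by Ruelle activities one vertex at a
time. -/
theorem partition_ne_zero (G : Graph α β) [Fintype V(G)] [Fintype E(G)] (lam : E(G) → ℝ)
    (hlam : ∀ e, 0 ≤ lam e) (u : ℝ) (x : V(G) → ℂ)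
    (hx : ∀ v, Admissible u (degree G Finset.univ v) (x v)) (S : Finset V(G)) :
    ∀ U : V(G) → ℕ → ℂ, (∀ v ∈ S, U v = fun k => ruelleActivity u k * x v ^ k) →
      (∀ v ∉ S, ∃ t ∈ pointedHalfPlane, U v = fun k => t ^ k) →
      partition G (fun e => (lam e : ℂ)) U ≠ 0 := by
  classical
  induction S using Finset.induction_on with
  | empty =>
    intro U _ hU
    choose t ht hUt using fun v => hU v (Finset.notMem_empty v)
    obtain rfl : U = fun v k => t v ^ k := funext hUt
    exact partition_pow_ne_zero G lam hlam t ht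
  | insert v S hv ih =>
    intro U hS hU
    set c : Finset E(G) → ℂ := fun H =>
      (∏ e ∈ H, (lam e : ℂ)) * ∏ w ∈ Finset.univ.erase v, U w (degree G H w) with hc
    -- Values of f are partition functions with powers at v, covered by `ih`; its coefficients give
    -- every other sequence at v.
    set f : ℂ[X] := ∑ H : Finset E(G), C (c H) * X ^ degree G H v with hf
    have hsplit : ∀ g : ℕ → ℂ, partition G (fun e => (lam e : ℂ)) (Function.update U v g) =
        ∑ H : Finset E(G), c H * g (degree G H v) := by
      intro g
      refine Finset.sum_congr rfl fun H _ => ?_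
      have h : ∏ w ∈ Finset.univ.erase v, Function.update U v g w (degree G H w) =
          ∏ w ∈ Finset.univ.erase v, U w (degree G H w) :=
        Finset.prod_congr rfl fun w hw => by
          rw [Function.update_of_ne (Finset.ne_of_mem_erase hw)]
      rw [weight, ← Finset.mul_prod_erase _ _ (Finset.mem_univ v), Function.update_self, h]
      simp only [hc]
      ring
    have hdeg : f.natDegree ≤ degree G Finset.univ v :=
      natDegree_sum_le_of_forall_le _ _ fun H _ =>
        (natDegree_C_mul_X_pow_le _ _).trans (degree_mono G (Finset.subset_univ H) v)
    have hz : ∀ t ∈ pointedHalfPlane, f.eval t ≠ 0 := by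
      intro t ht
      have he : f.eval t = partition G (fun e => (lam e : ℂ))
          (Function.update U v fun k => t ^ k) := by
        rw [hsplit, hf, eval_finsetSum]
        simp
      rw [he]
      refine ih _ (fun w hw => ?_) fun w hw => ?_
      · have hwv : w ≠ v := by rintro rfl; exact hv hw
        rw [Function.update_of_ne hwv]
        exact hS w (Finset.mem_insert_of_mem hw)
      · by_cases hwv : w = v
        · subst hwv
          exact ⟨t, ht, by rw [Function.update_self]⟩
        · rw [Function.update_of_ne hwv]
          exact hU w (by simp [hwv, hw])
    have hUv : partition G (fun e => (lam e : ℂ)) U =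
        f.coeff 0 + f.coeff 1 * (u * x v) + f.coeff 2 * x v ^ 2 := by
      conv_lhs => rw [← Function.update_eq_self v U]
      rw [hsplit, hS v (Finset.mem_insert_self v S)]
      simp only [hf, finsetSum_coeff, coeff_C_mul_X_pow, Finset.sum_mul,
        ← Finset.sum_add_distrib]
      refine Finset.sum_congr rfl fun H _ => ?_
      rcases hk : degree G H v with _ | _ | _ | k <;> simp [ruelleActivity]
    rw [hUv]
    exact sum_coeff_mul_ruelleActivity_ne_zero (hx v) f hdeg hz

theorem eval_Z_ne_zero (G : Graph α β) [Fintype V(G)] [Fintype E(G)] (lam : E(G) → ℝ)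
    (hlam : ∀ e, 0 ≤ lam e) (u : ℝ) (x : V(G) → ℂ)
    (hx : ∀ v, Admissible u (degree G Finset.univ v) (x v)) :
    MvPolynomial.eval x (Z G (fun e => (lam e : ℂ)) (fun _ => ruelleActivity u)) ≠ 0 := by
  have h := partition_ne_zero G lam hlam u x hx Finset.univ
    (fun v k => ruelleActivity u k * x v ^ k) (fun _ _ => rfl) (by simp)
  convert h using 1
  simp only [Z, partition, weight, map_sum, map_mul, map_prod, map_pow, MvPolynomial.eval_C,
    MvPolynomial.eval_X, Finset.prod_mul_distrib, mul_assoc]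

theorem eval_Zuni_sq (G : Graph α β) [Fintype V(G)] [Fintype E(G)] (lam : E(G) → ℂ)
    (u : V(G) → ℕ → ℂ) (x : ℂ) :
    (Zuni G lam u).eval (x ^ 2) = MvPolynomial.eval (fun _ => x) (Z G lam u) := by
  rw [← Polynomial.expand_eval, expand_two_Zuni, ← Polynomial.coe_aeval_eq_eval,
    ← MvPolynomial.coe_aeval_eq_eval]
  change ((Polynomial.aeval x).comp (MvPolynomial.aeval fun _ => Polynomial.X)) _ =
    MvPolynomial.aeval _ _
  congr 1
  ext v
  simp

/-! ### Sectors and admissible values. -/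

theorem polar_mem_sector {r φ θ : ℝ} (hr : 0 < r) (hφ : |φ| < θ) (hθ : θ ≤ Real.pi) :
    (r : ℂ) * Complex.exp (φ * Complex.I) ∈ sector θ := by
  refine ⟨mul_ne_zero (by exact_mod_cast hr.ne') (Complex.exp_ne_zero _), ?_⟩
  have h := abs_lt.1 hφ
  rwa [Complex.exp_mul_I, Complex.arg_mul_cos_add_sin_mul_I hr ⟨by linarith, by linarith⟩]

/-- The argument is split in the ratio θ : η and the modulus evenly, so for θ = η the common factor
is a square root of z. -/
theorem exists_mul_eq_of_mem_sector {θ η : ℝ} (hθ : 0 < θ) (hη : 0 < η) (hθπ : θ ≤ Real.pi)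
    (hηπ : η ≤ Real.pi) {z : ℂ} (hz : z ∈ sector (θ + η)) :
    ∃ x ∈ sector θ, ∃ w ∈ sector η, x * w = z ∧ (θ = η → x = w) := by
  obtain ⟨hz0, hz⟩ := hz
  have hn : 0 < √‖z‖ := Real.sqrt_pos.2 (norm_pos_iff.2 hz0)
  have hs : 0 < θ + η := (abs_nonneg _).trans_lt hz
  have hq : |z.arg / (θ + η)| < 1 := by rwa [abs_div, abs_of_pos hs, div_lt_one hs]
  have hlt : ∀ τ : ℝ, 0 < τ → |τ * (z.arg / (θ + η))| < τ := fun τ hτ => by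
    rw [abs_mul, abs_of_pos hτ]
    exact mul_lt_of_lt_one_right hτ hq
  refine ⟨_, polar_mem_sector hn (hlt θ hθ) hθπ, _, polar_mem_sector hn (hlt η hη) hηπ, ?_, ?_⟩
  · rw [mul_mul_mul_comm, ← Complex.exp_add, ← Complex.ofReal_mul,
      Real.mul_self_sqrt (norm_nonneg z), ← add_mul, ← Complex.ofReal_add, ← add_mul,
      mul_div_cancel₀ _ hs.ne', Complex.norm_mul_exp_arg_mul_I]
  · rintro rfl
    rfl

theorem re_pos_of_mem_sector {z : ℂ} (hz : z ∈ sector (Real.pi / 2)) : 0 < z.re := by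
  have := Complex.abs_arg_lt_pi_div_two_iff.1 hz.2
  exact this.resolve_right hz.1

theorem abs_im_lt_re_of_mem_sector {z : ℂ} (hz : z ∈ sector (Real.pi / 4)) : |z.im| < z.re := by
  obtain ⟨h0, h⟩ := hz
  have hn : 0 < ‖z‖ := norm_pos_iff.2 h0
  have hpi := Real.pi_pos
  have ha := abs_nonneg z.arg
  have hc : 0 < Real.cos (|z.arg| + Real.pi / 4) :=
    Real.cos_pos_of_mem_Ioo ⟨by linarith, by linarith⟩
  rw [Real.cos_add, Real.cos_pi_div_four, Real.sin_pi_div_four, ← sub_mul] at hc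
  have hcs := pos_of_mul_pos_left hc (by positivity)
  rw [Real.cos_abs, ← Real.abs_sin_eq_sin_abs_of_abs_le_pi (Complex.abs_arg_le_pi z)] at hcs
  have him : |z.im| = ‖z‖ * |Real.sin z.arg| := by
    rw [← Complex.norm_mul_sin_arg z, abs_mul, abs_of_pos hn]
  rw [him, ← Complex.norm_mul_cos_arg z]
  exact mul_lt_mul_of_pos_left (sub_pos.1 hcs) hn

/-- The wᵢ are x times the roots of w² - dw + d(d - 1)/2, namely (d ± iq)/2 with q² = d² - 2d. Since
q ≤ d, these turn x by at most π/4. -/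
theorem admissible_one {x : ℂ} (hx : x ∈ sector (Real.pi / 4)) (d : ℕ) : Admissible 1 d x := by
  have h := abs_im_lt_re_of_mem_sector hx
  have hre : 0 < x.re := (abs_nonneg _).trans_lt h
  refine ⟨fun _ => Or.inr (by simpa using hre), fun hd => ?_⟩
  have hdR : (2 : ℝ) ≤ d := by exact_mod_cast hd
  set q := √((d : ℝ) ^ 2 - 2 * d) with hq
  have hq0 : 0 ≤ q := Real.sqrt_nonneg _
  have hq2 : q ^ 2 = (d : ℝ) ^ 2 - 2 * d := Real.sq_sqrt (by nlinarith)
  have hqd : q ≤ d := abs_le_of_sq_le_sq' (by linarith) (by linarith) |>.2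
  have hq2' : (q : ℂ) ^ 2 = (d : ℂ) ^ 2 - 2 * d := by exact_mod_cast hq2
  have hqx : |q * x.im| < d * x.re := by
    rw [abs_mul, abs_of_nonneg hq0]
    exact mul_lt_mul_of_le_of_lt_of_nonneg_of_pos hqd h (abs_nonneg _) (by linarith)
  obtain ⟨h1, h2⟩ := abs_lt.1 hqx
  refine ⟨((d / 2 : ℝ) + (q / 2 : ℝ) * Complex.I) * x, ((d / 2 : ℝ) - (q / 2 : ℝ) * Complex.I) * x,
    ?_, ?_, ?_, ?_⟩
  · rw [Complex.mul_re]; simp; linarith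
  · rw [Complex.mul_re]; simp; linarith
  · push_cast; ring
  · push_cast
    linear_combination (x ^ 2 / 2) * hq2' - (q : ℂ) ^ 2 / 2 * x ^ 2 * Complex.I_sq

/-- The discriminant (du)² - 2d(d - 1) is nonnegative exactly when u² ≥ 2 - 2/d, a bound increasing
in d, so the maximum degree decides. The wᵢ are then positive multiples of x. -/
theorem admissible_of_sqrt_le {u : ℝ} {n d : ℕ} (hdn : d ≤ n)
    (hu : 1 ≤ n → √(2 - 2 / (n : ℝ)) ≤ u) {x : ℂ} (hx : 0 < x.re) : Admissible u d x := by
  refine ⟨fun hd => ?_, fun hd => ?_⟩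
  · have hu0 : 0 ≤ u := (Real.sqrt_nonneg _).trans (hu (by omega))
    -- u = 0 can occur when n = 1; then u x is the origin.
    rcases hu0.eq_or_lt with rfl | hu0
    · left; simp
    · right
      rw [Complex.re_ofReal_mul]
      exact mul_pos hu0 hx
  · have hdR : (2 : ℝ) ≤ d := by exact_mod_cast hd
    have hnR : (d : ℝ) ≤ n := by exact_mod_cast hdn
    have hu1 := hu (by omega)
    have hu0 : 0 ≤ u := (Real.sqrt_nonneg _).trans hu1
    have hu2 : 2 - 2 / (d : ℝ) ≤ u ^ 2 := by
      have h1 := (Real.sqrt_le_left hu0).1 hu1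
      have h2 : 2 / (n : ℝ) ≤ 2 / d := by gcongr
      linarith
    have hdu : 0 ≤ (d * u) ^ 2 - 2 * d * (d - 1) := by
      have h3 : (d : ℝ) ^ 2 * (2 - 2 / d) = 2 * d * (d - 1) := by field_simp
      nlinarith [mul_le_mul_of_nonneg_left hu2 (sq_nonneg (d : ℝ))]
    set D := √((d * u) ^ 2 - 2 * d * (d - 1)) with hD
    have hD0 : 0 ≤ D := Real.sqrt_nonneg _
    have hD2 : D ^ 2 = (d * u) ^ 2 - 2 * d * (d - 1) := Real.sq_sqrt hdu
    have hDlt : D < d * u := by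
      refine lt_of_pow_lt_pow_left₀ 2 (by positivity) ?_
      nlinarith
    have hD2' : (D : ℂ) ^ 2 = (d * u) ^ 2 - 2 * d * (d - 1) := by exact_mod_cast hD2
    refine ⟨((d * u + D) / 2 : ℝ) * x, ((d * u - D) / 2 : ℝ) * x, ?_, ?_, ?_, ?_⟩
    · rw [Complex.re_ofReal_mul]; exact mul_pos (by linarith) hx
    · rw [Complex.re_ofReal_mul]; exact mul_pos (by linarith) hx
    · push_cast; ring
    · push_cast
      linear_combination (-x ^ 2 / 2) * hD2'

/-! ### Key polynomials, Z(y) and the theorem. -/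

open Polynomial in
theorem eval_key_ne_zero (G : Graph α β) [Fintype E(G)] (v : V(G)) {u : ℝ} {x w : ℂ}
    (hx : Admissible u (degree G Finset.univ v) x) (hw : 0 < w.re) :
    (key G (fun _ => ruelleActivity u) v).eval (x * w) ≠ 0 := by
  rw [key]
  generalize degree G Finset.univ v = d at *
  -- The coefficients of (1 + wX)^d are the binomials of the key polynomial, with w^k.
  have h := sum_coeff_mul_ruelleActivity_ne_zero hx ((1 + C w * X) ^ d)
    ((natDegree_pow_le_of_le d (by compute_degree : (1 + C w * X).natDegree ≤ 1)).trans (by simp))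
    fun t ht => by
      rw [eval_pow]
      refine pow_ne_zero d ?_
      simpa using one_add_mul_ne_zero zero_le_one (Or.inr hw) ht
  have hcoeff : ∀ k, ((1 + C w * X) ^ d).coeff k = (d.choose k : ℂ) * w ^ k := by
    intro k
    have : ((1 + C w * X) ^ d : ℂ[X]) = ((1 + X) ^ d).comp (C w * X) := by simp
    rw [this, comp_C_mul_X_coeff, coeff_one_add_X_pow]
  rw [hcoeff, hcoeff, hcoeff] at h
  convert h using 1
  rw [eval_finsetSum]
  simp only [eval_mul, eval_C, eval_pow, eval_X]
  have hsum : ∑ j ∈ Finset.range (d + 1), (d.choose j : ℂ) * ruelleActivity u j * (x * w) ^ j =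
      ∑ j ∈ Finset.range 3, (d.choose j : ℂ) * ruelleActivity u j * (x * w) ^ j := by
    rcases Nat.le_total (d + 1) 3 with hd | hd
    · refine Finset.sum_subset (Finset.range_mono hd) fun j _ hj => ?_
      rw [Nat.choose_eq_zero_of_lt (by simpa using hj)]
      simp
    · symm
      refine Finset.sum_subset (Finset.range_mono hd) fun j _ hj => ?_
      have hj : 3 ≤ j := by simpa using hj
      have hz : ruelleActivity u j = 0 := by
        rw [ruelleActivity, if_neg (by omega), if_neg (by omega)]
      simp [hz]
  rw [hsum]
  simp [Finset.sum_range_succ, ruelleActivity]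
  ring

theorem eval_Zuni_ne_zero (G : Graph α β) [Fintype V(G)] [Fintype E(G)] (lam : E(G) → ℝ)
    (hlam : ∀ e, 0 ≤ lam e) (u : ℝ) {θ : ℝ} (hθ : 0 < θ) (hθπ : θ ≤ Real.pi)
    (h : ∀ x ∈ sector θ, ∀ v, Admissible u (degree G Finset.univ v) x) {y : ℂ}
    (hy : y ∈ sector (θ + θ)) :
    (Zuni G (fun e => (lam e : ℂ)) (fun _ => ruelleActivity u)).eval y ≠ 0 := by
  obtain ⟨x, hx, w, -, rfl, hxw⟩ := exists_mul_eq_of_mem_sector hθ hθ hθπ hθπ hy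
  rw [← hxw rfl, ← pow_two, eval_Zuni_sq]
  exact eval_Z_ne_zero G lam hlam u _ (h x hx)

theorem real_nonpos_of_notMem_sector_pi {y : ℂ} (hy : y ∉ sector Real.pi) :
    y.im = 0 ∧ y.re ≤ 0 := by
  by_cases h0 : y = 0
  · simp [h0]
  · have h : ¬ |y.arg| < Real.pi := fun h => hy ⟨h0, h⟩
    rw [abs_lt, not_and] at h
    have harg : y.arg = Real.pi :=
      le_antisymm (Complex.arg_le_pi y) (not_lt.1 (h (Complex.neg_pi_lt_arg y)))
    obtain ⟨h1, h2⟩ := Complex.arg_eq_pi_iff.1 harg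
    exact ⟨h2, h1.le⟩

end SubgraphPoly

open SubgraphPoly in
theorem mainTheorem5 {α β : Type*} (G : Graph α β) [Fintype V(G)] [Fintype E(G)]
    (lam : E(G) → ℝ) (hlam : ∀ e, 0 ≤ lam e) :
    ((∀ v, SubgraphPoly.Nonvanishing₁ (SubgraphPoly.sector (3 * Real.pi / 4))
        (SubgraphPoly.key G (fun _ => SubgraphPoly.ruelleActivity 1) v)) ∧
      SubgraphPoly.Nonvanishing (SubgraphPoly.sector (Real.pi / 4))
        (SubgraphPoly.Z G (fun e => (lam e : ℂ)) (fun _ => SubgraphPoly.ruelleActivity 1)) ∧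
      SubgraphPoly.Nonvanishing₁ (SubgraphPoly.sector (Real.pi / 2))
        (SubgraphPoly.Zuni G (fun e => (lam e : ℂ)) (fun _ => SubgraphPoly.ruelleActivity 1))) ∧
    ∀ u : ℝ,
      (1 ≤ SubgraphPoly.maxDegree G → √(2 - 2 / (SubgraphPoly.maxDegree G : ℝ)) ≤ u) →
      (∀ v, SubgraphPoly.Nonvanishing₁ (SubgraphPoly.sector Real.pi)
        (SubgraphPoly.key G (fun _ => SubgraphPoly.ruelleActivity u) v)) ∧
      SubgraphPoly.Nonvanishing (SubgraphPoly.sector (Real.pi / 2))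
        (SubgraphPoly.Z G (fun e => (lam e : ℂ)) (fun _ => SubgraphPoly.ruelleActivity u)) ∧
      SubgraphPoly.Nonvanishing₁ (SubgraphPoly.sector Real.pi)
        (SubgraphPoly.Zuni G (fun e => (lam e : ℂ)) (fun _ => SubgraphPoly.ruelleActivity u)) ∧
      ∀ y : ℂ,
        (SubgraphPoly.Zuni G (fun e => (lam e : ℂ))
          (fun _ => SubgraphPoly.ruelleActivity u)).eval y = 0 →
        y.im = 0 ∧ y.re ≤ 0 := by
  have hpi := Real.pi_pos
  have hadm : ∀ x ∈ sector (Real.pi / 4), ∀ v, Admissible 1 (degree G Finset.univ v) x :=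
    fun x hx v => admissible_one hx _
  refine ⟨⟨fun v => Or.inr fun z hz => ?_, Or.inr fun z hz => ?_, Or.inr fun y hy => ?_⟩,
    fun u hu => ?_⟩
  -- The angle π/4 comes from x, the angle π/2 from w.
  · rw [show 3 * Real.pi / 4 = Real.pi / 4 + Real.pi / 2 by ring] at hz
    obtain ⟨x, hx, w, hw, rfl, -⟩ := exists_mul_eq_of_mem_sector (by linarith) (by linarith)
      (by linarith) (by linarith) hz
    exact eval_key_ne_zero G v (hadm x hx v) (re_pos_of_mem_sector hw)
  · exact eval_Z_ne_zero G lam hlam 1 z fun v => hadm _ (hz v) v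
  · rw [show Real.pi / 2 = Real.pi / 4 + Real.pi / 4 by ring] at hy
    exact eval_Zuni_ne_zero G lam hlam 1 (by linarith) (by linarith) hadm hy
  · have hadm : ∀ x ∈ sector (Real.pi / 2), ∀ v, Admissible u (degree G Finset.univ v) x :=
      fun x hx v => admissible_of_sqrt_le (n := maxDegree G)
        (Finset.le_sup (f := fun v : V(G) => degree G Finset.univ v) (Finset.mem_univ v)) hu
        (re_pos_of_mem_sector hx)
    have hZ : ∀ y ∈ sector Real.pi,
        (Zuni G (fun e => (lam e : ℂ)) (fun _ => ruelleActivity u)).eval y ≠ 0 := by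
      intro y hy
      rw [show Real.pi = Real.pi / 2 + Real.pi / 2 by ring] at hy
      exact eval_Zuni_ne_zero G lam hlam u (by linarith) (by linarith) hadm hy
    refine ⟨fun v => Or.inr fun z hz => ?_, Or.inr fun z hz => ?_, Or.inr hZ, fun y hy => ?_⟩
    · rw [show Real.pi = Real.pi / 2 + Real.pi / 2 by ring] at hz
      obtain ⟨x, hx, w, hw, rfl, -⟩ := exists_mul_eq_of_mem_sector (by linarith) (by linarith)
        (by linarith) (by linarith) hz
      exact eval_key_ne_zero G v (hadm x hx v) (re_pos_of_mem_sector hw)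
    · exact eval_Z_ne_zero G lam hlam u z fun v => hadm _ (hz v) v
    · exact real_nonpos_of_notMem_sector_pi fun h => hZ y h hy
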